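/- Diagrams are ZH-diagrams built from white spiders and H-boxes, interpreted as matrices in the computational basis; a white spider has $1$ as its all-zeros and all-ones entries and $0$ elsewhere (with no legs it is the scalar $2$), a grey spider has entry $1$ where the number of ones on its legs is even and $0$ elsewhere (it is a white spider with Hadamard H-boxes on its legs, times $1/2$), and an H-box with complex label $a$ has $a$ as its all-ones entry and $1$ elsewhere, and an exponentiated H-box with label $\alpha\in\mathbb C$ is the H-box with label $e^{i\alpha}$. Let $n\ge 0$ and $\mathbb B=\{0,1\}$. For a vector $a=(a_{\vec b})_{\vec b\in\mathbb B^n}$ of complex numbers, the ZH normal form $\mathrm{NF}(a)$ is the diagram with $n$ outputs, each ending in a white spider, in which for every $\vec b\in\mathbb B^n$ an H-box labelled $a_{\vec b}$ with $n$ legs is connected to the $n$ white spiders, its $i$-th leg passing through a NOT gate exactly when $b_i=0$. For $\alpha=(\alpha_{\vec b})_{\vec b\in\mathbb B^n}$ let $\mathrm{NF}_{\exp}(\alpha)$ be the same diagram with exponentiated H-boxes labelled $\alpha_{\vec b}$. For $\beta=(\beta_{\vec c})_{\vec c\in\mathbb B^n}$ let $\mathrm{FT}(\beta)$ be the diagram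 with $n$ outputs, each ending in a white spider, in which for every $\vec c\in\mathbb B^n$ a phase gadget (a grey spider with one leg ending in a one-legged exponentiated H-box labelled $\beta_{\vec c}$) is connected to the $i$-th white spider for exactly those $i$ with $c_i=1$. **Theorem.** Every ZH normal form can be approximated to arbitrary precision by a normal form made of exponentiated H-boxes, and hence by a Fourier transform. Precisely, let $a\in\mathbb C^{\mathbb B^n}$ and $\varepsilon>0$, and put $$\alpha_{\vec b}=\begin{cases}-i\ln a_{\vec b}&\text{if }a_{\vec b}\ne 0,\\ -i\ln\varepsilon&\text{if }a_{\vec b}=0,\end{cases}\qquad \widetilde\alpha_{\vec c}=\frac{-1}{2^{n-1}}\sum_{\vec b\in\mathbb B^n}\alpha_{\vec b}\,(-1)^{\vec b\cdot\vec c},$$ where $\ln$ is the principal branch of the complex logarithm. Then: 1. $\mathrm{NF}_{\exp}(\alpha)$ is the normal form $\mathrm{NF}(a')$, where $a'_{\vec b}=a_{\vec b}$ if $a_{\vec b}\neq 0$ and $a'_{\vec b}=\varepsilon$ if $a_{\vec b}=0$; 2. each entry of the matrix of $\mathrm{NF}_{\exp}(\alpha)$ differs from the corresponding entry of the matrix of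 $\mathrm{NF}(a)$ by at most $\varepsilon$ in absolute value; 3. $\mathrm{NF}_{\exp}(\alpha)$ equals the diagram of phase gadgets $\mathrm{FT}(\widetilde\alpha)$ up to a nonzero scalar factor, that is, the matrix of the former is a nonzero complex multiple of the matrix of the latter. -/

import Mathlib

/-- ZH-diagrams. `ZHDiagram ι κ` is the type of diagrams whose input wires are labelled by `ι` and
whose output wires are labelled by `κ` (finite types in all uses). The generators are the white
spiders and the H-boxes with a complex label; diagrams are rewired (`wires`), stacked (`comp D E`
is `D` at the bottom and `E` on top of it), placed side by side (`beside`) and replicated in an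
indexed !-box (`bang`, the side-by-side placement of a finite family). -/
inductive ZHDiagram : Type → Type → Type 1
  | zSpider (ι κ : Type) [Fintype ι] [Fintype κ] : ZHDiagram ι κ
  | hBox (ι κ : Type) [Fintype ι] [Fintype κ] (a : ℂ) : ZHDiagram ι κ
  | wires {ι κ : Type} (e : ι ≃ κ) : ZHDiagram ι κ
  | comp {ι κ μ : Type} [Fintype κ] (D : ZHDiagram ι κ) (E : ZHDiagram κ μ) : ZHDiagram ι μ
  | beside {ι κ ι' κ' : Type} (D : ZHDiagram ι κ) (E : ZHDiagram ι' κ') :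
      ZHDiagram (ι ⊕ ι') (κ ⊕ κ')
  | bang {S : Type} [Fintype S] {ι κ : S → Type} (D : (s : S) → ZHDiagram (ι s) (κ s)) :
      ZHDiagram ((s : S) × ι s) ((s : S) × κ s)

namespace ZHDiagram

open Classical in
/-- The linear map represented by a diagram, as a matrix in the computational basis: the rows are
the bit assignments of the outputs and the columns are those of the inputs. -/
noncomputable def interp : {ι κ : Type} → ZHDiagram ι κ → Matrix (κ → Bool) (ι → Bool) ℂ
  | _, _, zSpider _ _ => Matrix.of fun y x =>
      (if (∀ i, x i = false) ∧ (∀ j, y j = false) then 1 else 0) +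
        (if (∀ i, x i = true) ∧ (∀ j, y j = true) then 1 else 0)
  | _, _, hBox _ _ a => Matrix.of fun y x => if (∀ i, x i = true) ∧ (∀ j, y j = true) then a else 1
  | _, _, wires e => Matrix.of fun y x => if ∀ i, y (e i) = x i then 1 else 0
  | _, _, comp D E => interp E * interp D
  | _, _, beside D E => Matrix.of fun y x =>
      interp D (fun j => y (Sum.inl j)) (fun i => x (Sum.inl i)) *
        interp E (fun j => y (Sum.inr j)) (fun i => x (Sum.inr i))
  | _, _, bang D => Matrix.of fun y x =>
      ∏ s, interp (D s) (fun j => y ⟨s, j⟩) (fun i => x ⟨s, i⟩)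

/-- Equality of diagrams when scalar factors are ignored: the matrices agree up to a nonzero
scalar. -/
def EqUpToScalar {ι κ : Type} (D E : ZHDiagram ι κ) : Prop :=
  ∃ c : ℂ, c ≠ 0 ∧ interp D = c • interp E

/-- The scalar `a`, drawn as an H-box without legs, next to the diagram `D`. -/
noncomputable def scale {ι κ : Type} [Fintype ι] [Fintype κ] (a : ℂ) (D : ZHDiagram ι κ) :
    ZHDiagram ι κ :=
  comp (wires (Equiv.emptySum Empty ι).symm)
    (comp (beside (hBox Empty Empty a) D) (wires (Equiv.emptySum Empty κ)))

/-- One single-wire diagram on each of the wires labelled by `ι`. -/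
def onWires {ι : Type} [Fintype ι] (D : ι → ZHDiagram Unit Unit) : ZHDiagram ι ι :=
  comp (wires ⟨fun i => ⟨i, ()⟩, fun p => p.1, fun _ => rfl, fun _ => rfl⟩)
    (comp (bang D) (wires ⟨fun p => p.1, fun i => ⟨i, ()⟩, fun _ => rfl, fun _ => rfl⟩))

/-- The unlabelled H-box with one input and one output: an unnormalised Hadamard gate. -/
noncomputable def hadamard : ZHDiagram Unit Unit := hBox Unit Unit (-1)

/-- The grey spider: a white spider with a Hadamard gate on every leg, normalised by `1/2`. -/
noncomputable def xSpider (ι κ : Type) [Fintype ι] [Fintype κ] : ZHDiagram ι κ :=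
  scale (1 / 2) (comp (onWires fun _ => hadamard)
    (comp (zSpider ι κ) (onWires fun _ => hadamard)))

/-- The NOT gate: conjugating by Hadamard gates the white spider to which an unlabelled one-legged
H-box is attached, normalised by `1/2`. -/
noncomputable def notGate : ZHDiagram Unit Unit :=
  scale (1 / 2) (comp hadamard
    (comp (comp (wires (Equiv.emptySum Empty Unit).symm)
      (comp (beside (hBox Empty Unit (-1)) (wires (Equiv.refl Unit))) (zSpider (Unit ⊕ Unit) Unit)))
      hadamard))

/-- The exponentiated H-box with label `α`, that is, the H-box labelled `e^{iα}`. -/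
noncomputable def expHBox (ι κ : Type) [Fintype ι] [Fintype κ] (α : ℂ) : ZHDiagram ι κ :=
  hBox ι κ (Complex.exp (Complex.I * α))

/-- The phase gadget with label `α` and `n` legs: a grey spider with `n` legs and a further one
which ends in a one-legged exponentiated H-box. -/
noncomputable def phaseGadget (n : ℕ) (α : ℂ) : ZHDiagram Empty (Fin n) :=
  comp (expHBox Empty Unit α) (xSpider Unit (Fin n))

/-- The indexing box of a bit string `b`: a NOT gate on wire `i` if `b i = 0`, and a plain wire if
`b i = 1`. -/
noncomputable def indexingBox {n : ℕ} (b : Fin n → Bool) : ZHDiagram (Fin n) (Fin n) :=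
  onWires fun i => if b i then wires (Equiv.refl Unit) else notGate

/-- The piece that separates a grey node (below) from a white node (above): the leg of the grey node
is closed by a one-legged grey spider and that of the white node by a one-legged white spider. -/
noncomputable def disconnectPiece : ZHDiagram Unit Unit :=
  comp (xSpider Unit Empty) (zSpider Empty Unit)

/-- The grey disconnect box of a bit string `c`: wire `i` is cut if `c i = 0`, and is a plain wire
if `c i = 1`. -/
noncomputable def disconnectBox {n : ℕ} (c : Fin n → Bool) : ZHDiagram (Fin n) (Fin n) :=
  onWires fun i => if c i then wires (Equiv.refl Unit) else disconnectPiece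

/-- For every bit string `b` a diagram `D b` with `n` outputs, the `i`-th of which is connected to
the `i`-th of `n` white spiders; each of these spiders has one further leg, which is an output. -/
def onWhiteSpiders {n : ℕ} (D : (Fin n → Bool) → ZHDiagram Empty (Fin n)) :
    ZHDiagram Empty (Fin n) :=
  comp (wires (κ := (_ : Fin n → Bool) × Empty)
      ⟨fun e => e.elim, fun p => p.2, fun e => e.elim, fun p => p.2.elim⟩)
    (comp (bang D)
      (comp (wires (κ := (_ : Fin n) × (Fin n → Bool))
          ⟨fun p => ⟨p.2, p.1⟩, fun p => ⟨p.2, p.1⟩, fun _ => rfl, fun _ => rfl⟩)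
        (comp (bang fun _ : Fin n => zSpider (Fin n → Bool) Unit)
          (wires ⟨fun p => p.1, fun i => ⟨i, ()⟩, fun _ => rfl, fun _ => rfl⟩))))

/-- The ZH normal form of the vector `∑ b, a b |b⟩`. -/
noncomputable def normalForm {n : ℕ} (a : (Fin n → Bool) → ℂ) : ZHDiagram Empty (Fin n) :=
  onWhiteSpiders fun b => comp (hBox Empty (Fin n) (a b)) (indexingBox b)

/-- The normal form made of exponentiated H-boxes with labels `α b`: the left-hand side of the
graphical Fourier transform. -/
noncomputable def expNormalForm {n : ℕ} (α : (Fin n → Bool) → ℂ) : ZHDiagram Empty (Fin n) :=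
  onWhiteSpiders fun b => comp (expHBox Empty (Fin n) (α b)) (indexingBox b)

/-- The diagram made of phase gadgets with labels `β c`, each connected through the grey disconnect
box of `c`: the right-hand side of the graphical Fourier transform. -/
noncomputable def fourierDiagram {n : ℕ} (β : (Fin n → Bool) → ℂ) : ZHDiagram Empty (Fin n) :=
  onWhiteSpiders fun c => comp (phaseGadget n (β c)) (disconnectBox c)

end ZHDiagram

/-- The parity function `χ(b, c) = (-1)^{b·c}`. -/
def parityChar {n : ℕ} (b c : Fin n → Bool) : ℂ := (-1) ^ (∑ i, (b i && c i).toNat)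

/-- The Fourier coefficients `α̃_c = -1 / 2^{n-1} ∑ b, α_b χ(b, c)`. -/
noncomputable def zhFourierCoeff {n : ℕ} (α : (Fin n → Bool) → ℂ) (c : Fin n → Bool) : ℂ :=
  -1 / (2 : ℂ) ^ ((n : ℤ) - 1) * ∑ b, α b * parityChar b c

/-- The exponents `α_b = -i ln a_b` if `a_b ≠ 0`, and `α_b = -i ln ε` if `a_b = 0`. -/
noncomputable def approxExponent {n : ℕ} (a : (Fin n → Bool) → ℂ) (ε : ℝ) (b : Fin n → Bool) : ℂ :=
  if a b = 0 then -Complex.I * Complex.log (ε : ℂ) else -Complex.I * Complex.log (a b)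

/-!
The matrix of `normalForm a` is the column vector `a`, which gives the first two claims.

A phase gadget with label `β` contributes the factor `exp (I * β)` where the number of ones on its
legs is odd and `1` where it is even. Hence the entry of `fourierDiagram β` at `y` is
`exp (I * ∑ c, β c * (1 - parityChar y c) / 2)`. By orthogonality of the parity functions, the
exponent for `β = zhFourierCoeff α` is `α y - α 0`, so the constant `exp (I * α 0)` is the scalar
between the two diagrams.
-/

lemma sum_fun_unique_bool {ι M : Type*} [Unique ι] [DecidableEq ι] [AddCommMonoid M]
    (f : (ι → Bool) → M) : ∑ x, f x = f (fun _ => true) + f (fun _ => false) := by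
  rw [← (Equiv.funUnique ι Bool).symm.sum_comp f, Fintype.sum_bool]
  rfl

namespace ZHDiagram

section Generators

variable {ι κ μ ι' κ' : Type}

lemma interp_hBox_apply [Fintype ι] [Fintype κ] (a : ℂ) (y : κ → Bool) (x : ι → Bool) :
    (hBox ι κ a).interp y x = if (∀ i, x i = true) ∧ (∀ j, y j = true) then a else 1 := by
  simp only [interp, Matrix.of_apply]

lemma interp_beside_apply (D : ZHDiagram ι κ) (E : ZHDiagram ι' κ') (y : κ ⊕ κ' → Bool)
    (x : ι ⊕ ι' → Bool) :
    (beside D E).interp y x =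
      D.interp (fun j => y (Sum.inl j)) (fun i => x (Sum.inl i)) *
        E.interp (fun j => y (Sum.inr j)) (fun i => x (Sum.inr i)) := by
  simp only [interp, Matrix.of_apply]

lemma interp_bang_apply {S : Type} [Fintype S] {ι κ : S → Type}
    (D : (s : S) → ZHDiagram (ι s) (κ s)) (y : ((s : S) × κ s) → Bool)
    (x : ((s : S) × ι s) → Bool) :
    (bang D).interp y x = ∏ s, (D s).interp (fun j => y ⟨s, j⟩) (fun i => x ⟨s, i⟩) := by
  simp only [interp, Matrix.of_apply]

lemma interp_comp_apply [Fintype κ] [DecidableEq κ] (D : ZHDiagram ι κ) (E : ZHDiagram κ μ)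
    (y : μ → Bool) (x : ι → Bool) :
    (comp D E).interp y x = ∑ w : κ → Bool, E.interp y w * D.interp w x := by
  simp only [interp, Matrix.mul_apply]
  exact Finset.sum_congr (by ext; simp) fun _ _ => rfl

lemma interp_wires_comp [Fintype κ] (e : ι ≃ κ) (D : ZHDiagram κ μ) (y : μ → Bool)
    (x : ι → Bool) : (comp (wires e) D).interp y x = D.interp y (x ∘ e.symm) := by
  classical
  have reindex (w : κ → Bool) : (∀ i, w (e i) = x i) ↔ w = x ∘ e.symm := by
    rw [e.eq_comp_symm, funext_iff]
    rfl
  rw [interp_comp_apply]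
  simp [interp, reindex]

lemma interp_comp_zSpider_comp {ν : Type} [Fintype κ] [Fintype μ] (D : ZHDiagram ι κ)
    (E : ZHDiagram μ ν) (y : ν → Bool) (x : ι → Bool) :
    (comp D (comp (zSpider κ μ) E)).interp y x =
      E.interp y (fun _ => false) * D.interp (fun _ => false) x +
        E.interp y (fun _ => true) * D.interp (fun _ => true) x := by
  classical
  simp only [interp_comp_apply]
  simp [interp, ← funext_iff, ite_and, mul_add, add_mul, Finset.sum_add_distrib]

end Generators

section Pullback

variable {ι κ μ : Type}

open Classical in
/-- The matrix of `E` sends a vector `v`, indexed by the bit assignments of the inputs, to its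
pullback `v ∘ f`. The pieces from which normal forms and Fourier diagrams connect their H-boxes to
the outputs all act in this way, so that composing with them only substitutes `f`. -/
def IsPullback (E : ZHDiagram ι κ) (f : (κ → Bool) → ι → Bool) : Prop :=
  ∀ y x, E.interp y x = if x = f y then 1 else 0

lemma isPullback_of_forall_bool {E : ZHDiagram Unit Unit} {f : Bool → Bool}
    (hE : ∀ s t, E.interp (fun _ => s) (fun _ => t) = if t = f s then 1 else 0) :
    E.IsPullback fun y _ => f (y ()) := by
  intro y x
  simpa only [funext_iff, Unique.forall_iff, PUnit.default_eq_unit] using hE (y ()) (x ())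

lemma isPullback_wires (e : ι ≃ κ) : (wires e).IsPullback fun y => y ∘ e := by
  classical
  intro y x
  simp only [interp, Matrix.of_apply]
  exact if_congr (by rw [eq_comm, funext_iff]; rfl) rfl rfl

lemma isPullback_zSpider_unit (ι : Type) [Fintype ι] :
    (zSpider ι Unit).IsPullback fun y _ => y () := by
  intro y x
  cases h : y () <;> simp [interp, h, funext_iff]

lemma IsPullback.interp_comp [Fintype κ] {E : ZHDiagram κ μ} {f : (μ → Bool) → κ → Bool}
    (hE : E.IsPullback f) (D : ZHDiagram ι κ) (y : μ → Bool) (x : ι → Bool) :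
    (D.comp E).interp y x = D.interp (f y) x := by
  classical
  rw [interp_comp_apply]
  simp [hE y]

protected lemma IsPullback.comp [Fintype κ] {D : ZHDiagram ι κ} {E : ZHDiagram κ μ}
    {f : (κ → Bool) → ι → Bool} {g : (μ → Bool) → κ → Bool} (hD : D.IsPullback f)
    (hE : E.IsPullback g) : (D.comp E).IsPullback (f ∘ g) := fun y x => by
  rw [hE.interp_comp, hD, Function.comp_apply]

protected lemma IsPullback.bang {S : Type} [Fintype S] {ι κ : S → Type}
    {D : (s : S) → ZHDiagram (ι s) (κ s)} {f : (s : S) → (κ s → Bool) → ι s → Bool}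
    (hD : ∀ s, (D s).IsPullback (f s)) :
    (ZHDiagram.bang D).IsPullback fun y p => f p.1 (fun j => y ⟨p.1, j⟩) p.2 := by
  classical
  intro y x
  rw [interp_bang_apply]
  simp only [hD _ _ _, Fintype.prod_ite_zero, Finset.prod_const_one]
  exact if_congr (by simp only [funext_iff, Sigma.forall]) rfl rfl

protected lemma IsPullback.onWires [Fintype ι] {D : ι → ZHDiagram Unit Unit} {f : ι → Bool → Bool}
    (hD : ∀ i, (D i).IsPullback fun y _ => f i (y ())) :
    (onWires D).IsPullback fun y i => f i (y i) :=
  (isPullback_wires _).comp ((IsPullback.bang hD).comp (isPullback_wires _))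

end Pullback

section Gates

variable {ι κ : Type}

lemma interp_scale [Fintype ι] [Fintype κ] (a : ℂ) (D : ZHDiagram ι κ) (y : κ → Bool)
    (x : ι → Bool) : (scale a D).interp y x = a * D.interp y x := by
  rw [scale, interp_wires_comp, (isPullback_wires _).interp_comp, interp_beside_apply,
    interp_hBox_apply, if_pos ⟨Empty.rec, Empty.rec⟩]
  rfl

lemma interp_onWires [Fintype ι] (D : ι → ZHDiagram Unit Unit) (y x : ι → Bool) :
    (onWires D).interp y x = ∏ i, (D i).interp (fun _ => y i) (fun _ => x i) := by
  rw [onWires, interp_wires_comp, (isPullback_wires _).interp_comp, interp_bang_apply]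
  rfl

lemma interp_hadamard (y x : Unit → Bool) :
    hadamard.interp y x = (-1) ^ (y () && x ()).toNat := by
  rw [hadamard, interp_hBox_apply]
  cases hx : x () <;> cases hy : y () <;> simp [hx, hy]

lemma interp_onWires_hadamard [Fintype ι] (y x : ι → Bool) :
    (onWires fun _ => hadamard).interp y x = (-1) ^ ∑ i, (y i && x i).toNat := by
  simp only [interp_onWires, interp_hadamard, Finset.prod_pow_eq_pow_sum]

lemma interp_xSpider [Fintype ι] [Fintype κ] (y : κ → Bool) (x : ι → Bool) :
    (xSpider ι κ).interp y x = if Even (∑ j, (y j).toNat + ∑ i, (x i).toNat) then 1 else 0 := by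
  rw [xSpider, interp_scale, interp_comp_zSpider_comp]
  simp only [interp_onWires_hadamard, Bool.and_false, Bool.false_and, Bool.and_true, Bool.true_and,
    Bool.toNat_false, Finset.sum_const_zero, pow_zero, ← pow_add]
  split_ifs with h
  · rw [h.neg_one_pow]
    norm_num
  · rw [(Nat.not_even_iff_odd.mp h).neg_one_pow]
    norm_num

lemma isPullback_notGate : notGate.IsPullback fun y _ => !(y ()) := by
  have phaseFlip (y x : Unit → Bool) :
      (comp (wires (Equiv.emptySum Empty Unit).symm)
        (comp (beside (hBox Empty Unit (-1)) (wires (Equiv.refl Unit)))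
          (zSpider (Unit ⊕ Unit) Unit))).interp y x =
        if y () = x () then (-1) ^ (y ()).toNat else 0 := by
    rw [interp_wires_comp, (isPullback_zSpider_unit _).interp_comp, interp_beside_apply,
      interp_hBox_apply]
    cases hx : x () <;> cases y () <;> simp [interp, hx]
  refine isPullback_of_forall_bool fun s t => ?_
  rw [notGate, interp_scale, interp_comp_apply]
  simp only [interp_comp_apply _ hadamard, sum_fun_unique_bool, phaseFlip, interp_hadamard]
  cases s <;> cases t <;> norm_num

lemma isPullback_disconnectPiece : disconnectPiece.IsPullback fun _ _ => false := by
  refine isPullback_of_forall_bool (f := fun _ => false) fun s t => ?_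
  rw [disconnectPiece, interp_comp_apply, Fintype.sum_unique, interp_xSpider]
  cases s <;> cases t <;> simp [interp]

lemma isPullback_indexingBox {n : ℕ} (b : Fin n → Bool) :
    (indexingBox b).IsPullback fun y i => y i == b i := by
  refine IsPullback.onWires (f := fun i t => t == b i) fun i => ?_
  cases b i
  · simpa using isPullback_notGate
  · simpa using isPullback_wires (Equiv.refl Unit)

lemma isPullback_disconnectBox {n : ℕ} (c : Fin n → Bool) :
    (disconnectBox c).IsPullback fun y i => y i && c i := by
  refine IsPullback.onWires (f := fun i t => t && c i) fun i => ?_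
  cases c i
  · simpa using isPullback_disconnectPiece
  · simpa using isPullback_wires (Equiv.refl Unit)

end Gates

section NormalForms

variable {n : ℕ}

lemma interp_onWhiteSpiders (D : (Fin n → Bool) → ZHDiagram Empty (Fin n)) (y : Fin n → Bool)
    (x : Empty → Bool) : (onWhiteSpiders D).interp y x = ∏ b, (D b).interp y x := by
  rw [onWhiteSpiders, interp_wires_comp,
    ((isPullback_wires _).comp ((IsPullback.bang fun _ => isPullback_zSpider_unit _).comp
      (isPullback_wires _))).interp_comp, interp_bang_apply]
  exact Finset.prod_congr rfl fun b _ => congrArg ((D b).interp y) (Subsingleton.elim _ _)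

lemma interp_normalForm (a : (Fin n → Bool) → ℂ) (y : Fin n → Bool) (x : Empty → Bool) :
    (normalForm a).interp y x = a y := by
  have hbox (b : Fin n → Bool) :
      (comp (hBox Empty (Fin n) (a b)) (indexingBox b)).interp y x = if y = b then a b else 1 := by
    simp [(isPullback_indexingBox b).interp_comp, interp_hBox_apply, funext_iff]
  simp only [normalForm, interp_onWhiteSpiders, hbox, Fintype.prod_ite_eq]

lemma expNormalForm_eq_normalForm (α : (Fin n → Bool) → ℂ) :
    expNormalForm α = normalForm fun b => Complex.exp (Complex.I * α b) := rfl

lemma interp_phaseGadget (β : ℂ) (y : Fin n → Bool) (x : Empty → Bool) :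
    (phaseGadget n β).interp y x =
      Complex.exp (Complex.I * (β * ((1 - (-1) ^ ∑ i, (y i).toNat) / 2))) := by
  rw [phaseGadget, expHBox, interp_comp_apply, sum_fun_unique_bool]
  simp only [interp_xSpider, interp_hBox_apply]
  rcases Nat.even_or_odd (∑ i, (y i).toNat) with h | h
  · simp [h, h.neg_one_pow]
  · simp [Nat.not_even_iff_odd.mpr h, h.neg_one_pow, Nat.even_add_one]

lemma interp_fourierDiagram (β : (Fin n → Bool) → ℂ) (y : Fin n → Bool) (x : Empty → Bool) :
    (fourierDiagram β).interp y x =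
      Complex.exp (Complex.I * ∑ c, β c * ((1 - parityChar y c) / 2)) := by
  simp only [fourierDiagram, interp_onWhiteSpiders, (isPullback_disconnectBox _).interp_comp,
    interp_phaseGadget, ← Complex.exp_sum, ← Finset.mul_sum, parityChar]

end NormalForms

end ZHDiagram

section Fourier

variable {n : ℕ}

lemma parityChar_false_left (c : Fin n → Bool) : parityChar (fun _ => false) c = 1 := by
  simp [parityChar]

lemma sum_parityChar_mul_parityChar (b y : Fin n → Bool) :
    ∑ c, parityChar b c * parityChar y c = if b = y then 2 ^ n else 0 := by
  have coordinate (s t : Bool) :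
      ∑ u : Bool, (-1 : ℂ) ^ (s && u).toNat * (-1) ^ (t && u).toNat = if s = t then 2 else 0 := by
    cases s <;> cases t <;> norm_num
  calc ∑ c, parityChar b c * parityChar y c
      = ∑ c : Fin n → Bool, ∏ i, (-1 : ℂ) ^ (b i && c i).toNat * (-1) ^ (y i && c i).toNat := by
        simp only [parityChar, ← Finset.prod_pow_eq_pow_sum, Finset.prod_mul_distrib]
    _ = ∏ i, if b i = y i then (2 : ℂ) else 0 := by
        rw [← Fintype.prod_sum fun i u => (-1 : ℂ) ^ (b i && u).toNat * (-1) ^ (y i && u).toNat]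
        simp only [coordinate]
    _ = if b = y then 2 ^ n else 0 := by
        simp [Fintype.prod_ite_zero, funext_iff]

lemma sum_zhFourierCoeff_mul_parityChar (α : (Fin n → Bool) → ℂ) (y : Fin n → Bool) :
    ∑ c, zhFourierCoeff α c * parityChar y c = -2 * α y := by
  calc ∑ c, zhFourierCoeff α c * parityChar y c
      = -1 / (2 : ℂ) ^ ((n : ℤ) - 1) * ∑ b, α b * ∑ c, parityChar b c * parityChar y c := by
        simp only [zhFourierCoeff, Finset.mul_sum, Finset.sum_mul, mul_assoc]
        exact Finset.sum_comm
    _ = -1 / (2 : ℂ) ^ ((n : ℤ) - 1) * (α y * 2 ^ n) := by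
        simp [sum_parityChar_mul_parityChar]
    _ = -2 * α y := by
        rw [zpow_sub₀ two_ne_zero, zpow_natCast, zpow_one]
        field_simp

lemma sum_zhFourierCoeff_mul_one_sub_parityChar (α : (Fin n → Bool) → ℂ) (y : Fin n → Bool) :
    ∑ c, zhFourierCoeff α c * ((1 - parityChar y c) / 2) = α y - α fun _ => false := by
  have total : ∑ c, zhFourierCoeff α c = -2 * α fun _ => false := by
    simpa only [parityChar_false_left, mul_one] using
      sum_zhFourierCoeff_mul_parityChar α fun _ => false
  simp only [← mul_div_assoc, ← Finset.sum_div, mul_sub, mul_one, Finset.sum_sub_distrib, total,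
    sum_zhFourierCoeff_mul_parityChar]
  ring

namespace ZHDiagram

theorem expNormalForm_eqUpToScalar_fourierDiagram (α : (Fin n → Bool) → ℂ) :
    EqUpToScalar (expNormalForm α) (fourierDiagram (zhFourierCoeff α)) := by
  refine ⟨Complex.exp (Complex.I * α fun _ => false), Complex.exp_ne_zero _, ?_⟩
  ext y x
  rw [Matrix.smul_apply, smul_eq_mul, expNormalForm_eq_normalForm, interp_normalForm,
    interp_fourierDiagram, sum_zhFourierCoeff_mul_one_sub_parityChar, ← Complex.exp_add, ← mul_add,
    add_sub_cancel]

end ZHDiagram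

end Fourier

lemma exp_I_mul_approxExponent {n : ℕ} (a : (Fin n → Bool) → ℂ) {ε : ℝ} (hε : ε ≠ 0)
    (b : Fin n → Bool) :
    Complex.exp (Complex.I * approxExponent a ε b) = if a b = 0 then (ε : ℂ) else a b := by
  have exp_log {z : ℂ} (hz : z ≠ 0) :
      Complex.exp (Complex.I * (-Complex.I * Complex.log z)) = z := by
    rw [← mul_assoc, mul_neg, Complex.I_mul_I, neg_neg, one_mul, Complex.exp_log hz]
  unfold approxExponent
  split_ifs with hb
  exacts [exp_log (Complex.ofReal_ne_zero.mpr hε), exp_log hb]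

lemma ZHDiagram.expNormalForm_approxExponent {n : ℕ} (a : (Fin n → Bool) → ℂ) {ε : ℝ}
    (hε : ε ≠ 0) :
    expNormalForm (approxExponent a ε) = normalForm fun b => if a b = 0 then (ε : ℂ) else a b := by
  simp only [expNormalForm_eq_normalForm, exp_I_mul_approxExponent a hε]

theorem mainTheorem4 (n : ℕ) (a : (Fin n → Bool) → ℂ) (ε : ℝ) (hε : 0 < ε) :
    -- the exponentiated normal form is the normal form in which each zero entry is replaced by `ε`
    ZHDiagram.expNormalForm (approxExponent a ε) =
      ZHDiagram.normalForm (fun b => if a b = 0 then (ε : ℂ) else a b) ∧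
    -- it approximates the given normal form up to `ε`
    (∀ (y : Fin n → Bool) (x : Empty → Bool),
      ‖(ZHDiagram.normalForm a).interp y x -
        (ZHDiagram.expNormalForm (approxExponent a ε)).interp y x‖ ≤ ε) ∧
    -- its graphical Fourier transform is the diagram of phase gadgets
    ZHDiagram.EqUpToScalar (ZHDiagram.expNormalForm (approxExponent a ε))
      (ZHDiagram.fourierDiagram (zhFourierCoeff (approxExponent a ε))) := by
  have replaced := ZHDiagram.expNormalForm_approxExponent a hε.ne'
  refine ⟨replaced, fun y x => ?_, ZHDiagram.expNormalForm_eqUpToScalar_fourierDiagram _⟩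
  rw [replaced, ZHDiagram.interp_normalForm, ZHDiagram.interp_normalForm]
  split_ifs with hy
  · simp [hy, abs_of_pos hε]
  · simpa using hε.le
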